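/- Write $x=(x_0,x_1,x_2)=(\rho\cos\theta,\rho\sin\theta\cos\phi,\rho\sin\theta\sin\phi)\in\mathbb{R}^3$, and let $\mathbb{B}^{\mathbf i}=\{x\in\mathbb{R}^3:|x|<1\}$, $\mathbb{B}^{\mathbf e}=\{x\in\mathbb{R}^3:|x|>1\}$. For $n\in\mathbb{Z}$ and an integer $m\ge 0$ let $P_n(t)={}_2F_1\big(-n,n+1;1;\tfrac{1-t}{2}\big)$ be the Legendre function of degree $n$ (so $P_n=P_{-n-1}$, and $P_n$ is the Legendre polynomial if $n\ge 0$), let $P_n^m(t)=(1-t^2)^{m/2}\frac{d^m}{dt^m}P_n(t)$ be the associated Legendre function, and let $$U_{n,m}^{\pm}(x)=\rho^n P_n^m(\cos\theta)\,\Phi_m^{\pm}(\phi),\qquad \Phi_m^+(\phi)=\cos(m\phi),\quad \Phi_m^-(\phi)=\sin(m\phi),$$ be the solid spherical harmonics. Let $e_1,e_2$ be the first two imaginary units of the real quaternions, and let $\partial=\frac{\partial}{\partial x_0}-e_1\frac{\partial}{\partial x_1}-e_2\frac{\partial}{\partial x_2}$. The basic spherical monogenics are $X_{n,m}^{\pm}=\partial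 U_{n+1,m}^{\pm}$; their values lie in $\operatorname{span}_{\mathbb{R}}\{1,e_1,e_2\}$. For functions $f=f_0+f_1e_1+f_2e_2$ on $\mathbb{B}^\sigma$, $\sigma\in\{\mathbf i,\mathbf e\}$, put $\|f\|_\sigma^2=\int_{\mathbb{B}^\sigma}(f_0^2+f_1^2+f_2^2)\,dV$. Let either $\sigma=\mathbf i$, $n\ge 0$ and $0\le m\le n+1$, or $\sigma=\mathbf e$, $n\le -2$ and $0\le m\le -n-2$, with $n,m$ integers; the superscript $-$ is excluded when $m=0$. Then $X_{n,m}^{\pm}$ is square integrable on $\mathbb{B}^\sigma$, and $$\|X_{n,m}^{\pm}\|_\sigma^2=\frac{2\pi(n+1)(\delta_{0,m}+1)\,\big(|n+\tfrac32|+m-\tfrac12\big)!}{(2n+3)\,\big(|n+\tfrac32|-m-\tfrac12\big)!},$$ where $\delta_{0,m}$ is the Kronecker symbol. -/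

import Mathlib

open MeasureTheory
open scoped Quaternion

namespace SphericalMonogenics

noncomputable section

/-- Euclidean three-space, with coordinates `x 0`, `x 1`, `x 2`. -/
abbrev R3 : Type := EuclideanSpace ℝ (Fin 3)

/-- The two domains: `i` (interior) and `e` (exterior). -/
inductive Side where
  | i
  | e

/-- The open unit ball and the exterior of the closed unit ball. -/
def domain : Side → Set R3
  | .i => {x | ‖x‖ < 1}
  | .e => {x | 1 < ‖x‖}

/-- The superscript `±`. -/
inductive Sgn where
  | plus
  | minus

/-- The angular factors `cos (m φ)` and `sin (m φ)`. -/
def angular : Sgn → ℕ → ℝ → ℝ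
  | .plus, m, φ => Real.cos (m * φ)
  | .minus, m, φ => Real.sin (m * φ)

/-- The Legendre function of the first kind `P_n` of integer degree `n` (of either sign),
`P_n(t) = ₂F₁(-n, n + 1; 1; (1 - t) / 2)`. The series is a finite sum, since `n` is an integer;
for `n ≥ 0` it is the Legendre polynomial. -/
def legendreP (n : ℤ) (t : ℝ) : ℝ :=
  ordinaryHypergeometric (-(n : ℝ)) ((n : ℝ) + 1) (1 : ℝ) ((1 - t) / 2)

/-- The associated Legendre function of degree `n` and order `m ≥ 0` on `[-1, 1]`,
`P_n^m(t) = (1 - t²)^{m/2} (d/dt)^m P_n(t)` (without the factor `(-1)^m`). -/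
def assocLegendre (n : ℤ) (m : ℕ) (t : ℝ) : ℝ :=
  Real.sqrt (1 - t ^ 2) ^ m * iteratedDeriv m (legendreP n) t

/-- The polar angle `θ ∈ [0, π]`, with `x₀ = ρ cos θ`. -/
def polarAngle (x : R3) : ℝ := Real.arccos (x 0 / ‖x‖)

/-- The azimuth `φ`, with `x₁ = ρ sin θ cos φ` and `x₂ = ρ sin θ sin φ`. -/
def azimuth (x : R3) : ℝ := Complex.arg ⟨x 1, x 2⟩

/-- The solid spherical harmonic `U_{n,m}^±(x) = ρ^n P_n^m(cos θ) Φ_m^±(φ)`. -/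
def solidHarmonic (n : ℤ) (m : ℕ) (s : Sgn) (x : R3) : ℝ :=
  ‖x‖ ^ n * assocLegendre n m (Real.cos (polarAngle x)) * angular s m (azimuth x)

/-- The partial derivative `∂f/∂x_j` of a quaternion-valued function. -/
def partialDeriv (j : Fin 3) (f : R3 → ℍ[ℝ]) (x : R3) : ℍ[ℝ] :=
  lineDeriv ℝ f x (EuclideanSpace.single j (1 : ℝ))

/-- The quaternion unit `e₁`. -/
def e1 : ℍ[ℝ] := ⟨0, 1, 0, 0⟩

/-- The quaternion unit `e₂`. -/
def e2 : ℍ[ℝ] := ⟨0, 0, 1, 0⟩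

/-- The operator `∂ = ∂/∂x₀ - e₁ ∂/∂x₁ - e₂ ∂/∂x₂`. -/
def cauchyRiemannConj (f : R3 → ℍ[ℝ]) (x : R3) : ℍ[ℝ] :=
  partialDeriv 0 f x - (e1 * partialDeriv 1 f x + e2 * partialDeriv 2 f x)

/-- The basic spherical monogenic `X_{n,m}^± = ∂ U_{n+1,m}^±`. -/
def basicMonogenic (n : ℤ) (m : ℕ) (s : Sgn) : R3 → ℍ[ℝ] :=
  cauchyRiemannConj (fun x => ((solidHarmonic (n + 1) m s x : ℝ) : ℍ[ℝ]))

/-- Admissible degrees: `n ≥ 0` in the interior and `n ≤ -2` in the exterior. -/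
def J : Side → Set ℤ
  | .i => {n | 0 ≤ n}
  | .e => {n | n ≤ -2}

/-- Orders of the solid harmonics of degree `n`. -/
def IH : Side → ℤ → Set ℕ
  | .i, n => {m | (m : ℤ) ≤ n}
  | .e, n => {m | (m : ℤ) ≤ -n - 1}

/-- Orders of the basic monogenics of degree `n`. -/
def IM (σ : Side) (n : ℤ) : Set ℕ := IH σ (n + 1)

/-- The scalar product `∫ (f₀g₀ + f₁g₁ + f₂g₂) dV` over the domain, for functions with values in
the span of `1`, `e₁`, `e₂`. -/
def scalarProduct (σ : Side) (f g : R3 → ℍ[ℝ]) : ℝ :=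
  ∫ x in domain σ, ((f x).re * (g x).re + (f x).imI * (g x).imI + (f x).imJ * (g x).imJ)

/-- The `L²` norm belonging to the scalar product. -/
def l2norm (σ : Side) (f : R3 → ℍ[ℝ]) : ℝ := Real.sqrt (scalarProduct σ f f)

/-- The factorial of a real number, `x! = Γ(x + 1)`. -/
def realFactorial (x : ℝ) : ℝ := Real.Gamma (x + 1)

/-- The Kronecker symbol. -/
def kronecker (k m : ℕ) : ℝ := if k = m then 1 else 0

end

end SphericalMonogenics

open SphericalMonogenics

/-! Put N = n + 1. The components of `basicMonogenic n m s` are, up to sign, the partial derivatives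
of the solid harmonic U of degree N, so the squared norm is the Dirichlet integral of U. By the
symmetry of the Legendre function under N ↦ -N - 1, its polar factor comes from the Legendre
polynomial of degree k, where N = k (interior) or N = -k - 1 (exterior); both give N(N + 1) = k(k +
1). In spherical coordinates |∇U|² = ρ^(2N-2) (Φ² D(cos θ) + A(cos θ)) with polynomials D and A
(`gradSq_sphericalPoint`). Integration over φ leaves π(δ + 1)(D + 2A), where δ is 1 for m = 0 and 0
otherwise. One integration by parts against the Legendre equation turns ∫(D + 2A) into N(2N + 1)
times the squared norm of the associated Legendre function (`integral_dirichletPoly`). That norm is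
2/(2k + 1) · (k + m)!/(k - m)! (`assocNormSq_eq`), and the radial integral of ρ^(2N) is 1/|2N + 1|.
Since |2N + 1| = 2k + 1, the product is the stated value. All integrals over space are lower
Lebesgue integrals of nonnegative functions, so finiteness, and with it square integrability, comes
with the value. -/

open Polynomial in
/-- The real polynomial `S_k(u) = ∑ (-1)^j C(k,j) C(k+j,k) u^j`. -/
noncomputable def realShiftedLegendre (k : ℕ) : ℝ[X] :=
  (shiftedLegendre k).map (Int.castRingHom ℝ)

open Polynomial in
/-- The Legendre polynomial of degree `k`. -/
noncomputable def legendrePoly (k : ℕ) : ℝ[X] :=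
  (realShiftedLegendre k).comp (C (1 / 2) * (1 - X))

/-! ### Legendre polynomials and their differential equation. -/

namespace SphericalMonogenics

open Polynomial

theorem coeff_realShiftedLegendre (k j : ℕ) :
    (realShiftedLegendre k).coeff j = (-1) ^ j * (k.choose j : ℝ) * ((k + j).choose k : ℝ) := by
  simp [realShiftedLegendre, coeff_shiftedLegendre]

/-- This two-term recurrence both identifies the hypergeometric series and encodes the differential
equation. -/
theorem coeff_realShiftedLegendre_succ (k j : ℕ) :
    ((j : ℝ) + 1) ^ 2 * (realShiftedLegendre k).coeff (j + 1) =
      (j - k) * (k + j + 1) * (realShiftedLegendre k).coeff j := by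
  simp only [coeff_realShiftedLegendre]
  have h1 : (k.choose (j + 1) : ℝ) * (j + 1) = k.choose j * ((k : ℝ) - j) := by
    rcases le_or_gt j k with h | h
    · have := Nat.choose_succ_right_eq k j
      rw [← Nat.cast_sub h]
      exact_mod_cast this
    · rw [Nat.choose_eq_zero_of_lt h, Nat.choose_eq_zero_of_lt (by omega)]
      simp
  have h2 : ((k + (j + 1)).choose k : ℝ) * (j + 1) = (k + j).choose k * ((k : ℝ) + j + 1) := by
    have := Nat.add_one_mul_choose_eq (k + j) j
    have e1 : (k + j).choose j = (k + j).choose k := by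
      rw [← Nat.choose_symm_add]
    have e2 : (k + j + 1).choose (j + 1) = (k + (j + 1)).choose k := by
      rw [Nat.add_assoc, ← Nat.choose_symm_add]
    rw [e1, e2] at this
    have h3 : ((k + j + 1 : ℕ) : ℝ) * ((k + j).choose k : ℝ) =
      ((k + (j + 1)).choose k : ℝ) * ((j + 1 : ℕ) : ℝ) := by exact_mod_cast this
    push_cast at h3
    linarith
  calc _ = -(-1) ^ j * ((k.choose (j + 1) : ℝ) * (j + 1)) *
        (((k + (j + 1)).choose k : ℝ) * (j + 1)) := by ring
    _ = _ := by rw [h1, h2]; ring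

theorem hypergeometricCoefficient_eq_coeff (k j : ℕ) :
    (((j.factorial : ℝ)⁻¹) * (ascPochhammer ℝ j).eval (-(k : ℝ)) *
      (ascPochhammer ℝ j).eval ((k : ℝ) + 1) * ((ascPochhammer ℝ j).eval (1 : ℝ))⁻¹) =
      (realShiftedLegendre k).coeff j := by
  induction j with
  | zero => simp [coeff_realShiftedLegendre]
  | succ j ih =>
    have hj : ((j : ℝ) + 1) ≠ 0 := by positivity
    have hf : (j.factorial : ℝ) ≠ 0 := by positivity
    have hp : (ascPochhammer ℝ j).eval (1 : ℝ) ≠ 0 :=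
      (ascPochhammer_pos j 1 one_pos).ne'
    have h := coeff_realShiftedLegendre_succ k j
    rw [← ih] at h
    apply mul_left_cancel₀ (pow_ne_zero 2 hj)
    rw [h]
    simp only [ascPochhammer_succ_eval, Nat.factorial_succ]
    push_cast
    have h1 : (1 : ℝ) + j ≠ 0 := by positivity
    field_simp
    ring

theorem legendreP_natCast (k : ℕ) (t : ℝ) : legendreP k t = (legendrePoly k).eval t := by
  have hdeg : (realShiftedLegendre k).natDegree < k + 1 := by
    refine Nat.lt_succ_of_le ?_
    refine natDegree_map_le.trans ?_
    simp
  rw [legendreP, ordinaryHypergeometric_eq_tsum]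
  simp only [Int.cast_natCast, hypergeometricCoefficient_eq_coeff]
  rw [tsum_eq_sum (s := Finset.range (k + 1))]
  · rw [legendrePoly, eval_comp, eval_eq_sum_range' hdeg]
    simp only [smul_eq_mul, eval_mul, eval_C, eval_sub, eval_one, eval_X]
    congr 1; ext j; congr 2; ring
  · intro j hj
    rw [coeff_eq_zero_of_natDegree_lt, zero_smul]
    simp at hj; omega

/-- The substitution swaps the two upper parameters, in which ₂F₁ is symmetric. -/
theorem legendreP_neg_sub_one (n : ℤ) : legendreP (-n - 1) = legendreP n := by
  ext t
  simp only [legendreP, ordinaryHypergeometric]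
  rw [ordinaryHypergeometricSeries_symm]
  push_cast
  congr 2 <;> ring

theorem iteratedDeriv_eval (p : ℝ[X]) (m : ℕ) (t : ℝ) :
    iteratedDeriv m (fun x => p.eval x) t = (derivative^[m] p).eval t := by
  induction m generalizing t with
  | zero => simp
  | succ m ih =>
    rw [iteratedDeriv_succ, funext ih, Polynomial.deriv, Function.iterate_succ_apply']

/-- Comparing coefficients of u^j gives exactly `coeff_realShiftedLegendre_succ`. -/
theorem realShiftedLegendre_ode (k : ℕ) :
    X * (1 - X) * derivative (derivative (realShiftedLegendre k)) +
      (1 - 2 * X) * derivative (realShiftedLegendre k) +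
      C ((k : ℝ) * (k + 1)) * realShiftedLegendre k = 0 := by
  set S := realShiftedLegendre k with hS
  -- Each power of X is isolated as a left factor, so that coefficient extraction is an index shift;
  -- the double shift forces the cases j = 0, j = 1 and j ≥ 2.
  have e : X * (1 - X) * derivative (derivative S) + (1 - 2 * X) * derivative S
      + C ((k : ℝ) * (k + 1)) * S =
    X * derivative (derivative S) - X * (X * derivative (derivative S)) + derivative S
      - C 2 * (X * derivative S) + C ((k : ℝ) * (k + 1)) * S := by
    simp only [map_ofNat]; ring
  rw [e]
  ext j
  simp only [coeff_add, coeff_sub, coeff_C_mul, coeff_zero]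
  have h := coeff_realShiftedLegendre_succ k j
  rw [← hS] at h
  rcases j with _ | _ | j
  · simp only [coeff_X_mul_zero, coeff_derivative] at *
    push_cast at *
    linear_combination h
  · simp only [coeff_X_mul, coeff_X_mul_zero, coeff_derivative] at *
    push_cast at *
    linear_combination h
  · simp only [coeff_X_mul, coeff_derivative] at *
    push_cast at *
    linear_combination h

theorem legendrePoly_ode (k : ℕ) :
    (1 - X ^ 2) * derivative (derivative (legendrePoly k)) - 2 * X * derivative (legendrePoly k) +
      C ((k : ℝ) * (k + 1)) * legendrePoly k = 0 := by
  have h := congrArg (fun p => p.comp (C (1 / 2 : ℝ) * (1 - X))) (realShiftedLegendre_ode k)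
  simp only [add_comp, mul_comp, sub_comp, X_comp, one_comp, C_comp, ofNat_comp, zero_comp] at h
  have hd : derivative (C (1 / 2 : ℝ) * (1 - X)) = -C (1 / 2) := by simp
  simp only [legendrePoly, derivative_comp, hd, derivative_mul, derivative_neg, derivative_C]
  set a := (derivative (derivative (realShiftedLegendre k))).comp (C (1 / 2 : ℝ) * (1 - X))
  set b := (derivative (realShiftedLegendre k)).comp (C (1 / 2 : ℝ) * (1 - X))
  have h2 : (C (1 / 2 : ℝ)) * 2 = 1 := by
    rw [← C_ofNat, ← C_mul]; norm_num
  set c : ℝ[X] := C (1 / 2 : ℝ)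
  linear_combination h + (b + (1 - X) * c * a) * h2

/-- The `m`-th derivative of the Legendre polynomial of degree `k`. -/
noncomputable def legendreDeriv (k m : ℕ) : ℝ[X] := derivative^[m] (legendrePoly k)

theorem derivative_legendreDeriv (k m : ℕ) :
    derivative (legendreDeriv k m) = legendreDeriv k (m + 1) := by
  simp only [legendreDeriv, Function.iterate_succ_apply']

theorem legendreDeriv_ode (k m : ℕ) :
    (1 - X ^ 2) * legendreDeriv k (m + 2) - 2 * ((m : ℝ[X]) + 1) * X * legendreDeriv k (m + 1) +
      C ((k : ℝ) * (k + 1) - m * (m + 1)) * legendreDeriv k m = 0 := by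
  induction m with
  | zero =>
    have := legendrePoly_ode k
    simp only [legendreDeriv, Function.iterate_succ_apply', Function.iterate_zero_apply] at *
    simpa using this
  | succ m ih =>
    have h := congrArg derivative ih
    simp only [derivative_add, derivative_sub, derivative_mul, derivative_legendreDeriv,
      derivative_C, derivative_X, derivative_one, derivative_X_pow, derivative_ofNat,
      derivative_natCast, derivative_zero] at h
    simp only [map_sub, map_mul, map_add, map_natCast, map_one, Nat.cast_add, Nat.cast_one,
      Nat.add_one_sub_one, pow_one] at *
    linear_combination h

/-! ### Polynomial integrals over [-1, 1] and the norm of the associated Legendre functions. -/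

theorem integral_eval_derivative (p : ℝ[X]) :
    ∫ t in (-1 : ℝ)..1, (derivative p).eval t = p.eval 1 - p.eval (-1) :=
  intervalIntegral.integral_eq_sub_of_hasDerivAt (fun t _ => p.hasDerivAt t)
    ((derivative p).continuous.intervalIntegrable _ _)

/-- Integration by parts in the form used below: r carries the boundary terms, which vanish. -/
theorem integral_eval_eq_of_derivative_eq {p q r : ℝ[X]} (h : derivative r = p - q)
    (h1 : r.eval 1 = 0) (h2 : r.eval (-1) = 0) :
    ∫ t in (-1 : ℝ)..1, p.eval t = ∫ t in (-1 : ℝ)..1, q.eval t := by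
  have := integral_eval_derivative r
  rw [h, h1, h2] at this
  simp only [eval_sub] at this
  rw [intervalIntegral.integral_sub (p.continuous.intervalIntegrable _ _)
    (q.continuous.intervalIntegrable _ _)] at this
  linarith

/-- The squared norm of the associated Legendre function. -/
noncomputable def assocNormSq (k m : ℕ) : ℝ :=
  ∫ t in (-1 : ℝ)..1, ((1 - X ^ 2) ^ m * legendreDeriv k m ^ 2).eval t

theorem integral_const_mul_eval (c : ℝ) (p : ℝ[X]) :
    ∫ t in (-1 : ℝ)..1, (C c * p).eval t = c * ∫ t in (-1 : ℝ)..1, p.eval t := by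
  simp [intervalIntegral.integral_const_mul]

/-- In Sturm–Liouville form, with Q the m-th derivative, ((1 - t²)^(m+1) Q')' is -(k - m)(k + m +
1)(1 - t²)^m Q; multiply by Q and integrate by parts. -/
theorem assocNormSq_succ (k m : ℕ) :
    assocNormSq k (m + 1) = ((k : ℝ) - m) * (k + m + 1) * assocNormSq k m := by
  rw [assocNormSq, assocNormSq, ← integral_const_mul_eval]
  refine integral_eval_eq_of_derivative_eq
    (r := (1 - X ^ 2) ^ (m + 1) * legendreDeriv k m * legendreDeriv k (m + 1)) ?_
    (by simp) (by simp)
  have h := legendreDeriv_ode k m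
  simp only [derivative_mul, derivative_legendreDeriv, derivative_pow, derivative_sub,
    derivative_one, derivative_X]
  simp only [map_sub, map_mul, map_add, map_natCast, map_one, map_ofNat, Nat.cast_add, Nat.cast_one,
      Nat.cast_ofNat, Nat.add_one_sub_one, pow_one] at *
  linear_combination (1 - X ^ 2) ^ m * legendreDeriv k m * h

/-- The primitive t(1 - t²)^(k+1) vanishes at both ends. -/
theorem integral_one_sub_sq_pow_succ (k : ℕ) :
    (2 * (k : ℝ) + 3) * ∫ t in (-1 : ℝ)..1, ((1 - X ^ 2) ^ (k + 1) : ℝ[X]).eval t =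
      (2 * (k : ℝ) + 2) * ∫ t in (-1 : ℝ)..1, ((1 - X ^ 2) ^ k : ℝ[X]).eval t := by
  rw [← integral_const_mul_eval, ← integral_const_mul_eval]
  refine integral_eval_eq_of_derivative_eq (r := X * (1 - X ^ 2) ^ (k + 1)) ?_
    (by simp) (by simp)
  simp only [derivative_mul, derivative_pow, derivative_sub,
    derivative_one, derivative_X]
  simp only [map_mul, map_add, map_natCast, Nat.cast_add, Nat.cast_one,
      Nat.cast_ofNat, Nat.add_one_sub_one, pow_one, map_ofNat, map_one]
  ring

theorem integral_one_sub_sq_pow (k : ℕ) :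
    ((2 * k + 1).factorial : ℝ) * ∫ t in (-1 : ℝ)..1, ((1 - X ^ 2) ^ k : ℝ[X]).eval t =
      2 * 4 ^ k * (k.factorial : ℝ) ^ 2 := by
  induction k with
  | zero => simp; norm_num
  | succ k ih =>
    have h := integral_one_sub_sq_pow_succ k
    have e : 2 * (k + 1) + 1 = (2 * k + 1) + 1 + 1 := by ring
    rw [e, Nat.factorial_succ, Nat.factorial_succ, Nat.factorial_succ k]
    push_cast
    linear_combination (2 * (k : ℝ) + 2) * (2 * k + 1).factorial * h + (2 * (k : ℝ) + 2) ^ 2 * ih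

theorem natDegree_realShiftedLegendre (k : ℕ) : (realShiftedLegendre k).natDegree = k := by
  rw [realShiftedLegendre, natDegree_map_eq_of_injective (RingHom.injective_int _),
    natDegree_shiftedLegendre]

theorem half_mul_one_sub_X :
    (C (1 / 2 : ℝ) * (1 - X)) = C (-1 / 2) * X + C (1 / 2) := by
  rw [show (-1 / 2 : ℝ) = -(1 / 2) by ring, C_neg]; ring

theorem natDegree_legendrePoly_le (k : ℕ) : (legendrePoly k).natDegree ≤ k := by
  rw [legendrePoly, natDegree_comp, natDegree_realShiftedLegendre, half_mul_one_sub_X,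
    natDegree_linear (by norm_num), mul_one]

theorem coeff_legendrePoly_self (k : ℕ) :
    (legendrePoly k).coeff k = ((2 * k).choose k : ℝ) / 2 ^ k := by
  have h2 : (C (-1 / 2 : ℝ) * X + C (1 / 2)).natDegree = 1 := natDegree_linear (by norm_num)
  have h := coeff_comp_degree_mul_degree (p := realShiftedLegendre k)
    (q := C (-1 / 2 : ℝ) * X + C (1 / 2)) (by rw [h2]; exact one_ne_zero)
  rw [h2, leadingCoeff, natDegree_realShiftedLegendre, leadingCoeff_linear (by norm_num),
    coeff_realShiftedLegendre, mul_one, ← half_mul_one_sub_X, Nat.choose_self, ← two_mul] at h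
  rw [legendrePoly, h, div_pow]
  have : (-1 : ℝ) ^ k * (-1) ^ k = 1 := by rw [← mul_pow]; norm_num
  linear_combination ((2 * k).choose k : ℝ) / 2 ^ k * this

theorem legendreDeriv_self (k : ℕ) :
    legendreDeriv k k = C (((2 * k).factorial : ℝ) / (2 ^ k * k.factorial)) := by
  have hd : (legendreDeriv k k).natDegree = 0 := by
    have := natDegree_iterate_derivative (legendrePoly k) k
    have := natDegree_legendrePoly_le k
    unfold legendreDeriv; omega
  rw [eq_C_of_natDegree_eq_zero hd, legendreDeriv, coeff_iterate_derivative]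
  simp only [zero_add, Nat.descFactorial_self, coeff_legendrePoly_self, nsmul_eq_mul]
  congr 1
  have h := Nat.choose_mul_factorial_mul_factorial (show k ≤ 2 * k by omega)
  rw [show 2 * k - k = k by omega] at h
  have h' : ((2 * k).choose k : ℝ) * k.factorial * k.factorial = (2 * k).factorial := by
    exact_mod_cast h
  rw [← h']
  field_simp

theorem assocNormSq_eq_mul_zero (k m : ℕ) (hm : m ≤ k) :
    assocNormSq k m * (k - m).factorial = (k + m).factorial * assocNormSq k 0 := by
  induction m with
  | zero => simp [mul_comm]
  | succ m ih =>
    have ih := ih (by omega)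
    rw [assocNormSq_succ]
    obtain ⟨d, rfl⟩ : ∃ d, k = m + 1 + d := ⟨k - (m + 1), by omega⟩
    rw [show m + 1 + d - (m + 1) = d by omega, ← add_assoc, Nat.factorial_succ]
    rw [show m + 1 + d - m = d + 1 by omega, Nat.factorial_succ] at ih
    push_cast at *
    linear_combination (2 * (m : ℝ) + d + 2) * ih

/-- The recursion in the order is run up to m = k, where the derivative is constant and the norm is
a beta integral; comparing the two ends determines the value at m = 0. -/
theorem assocNormSq_zero (k : ℕ) : assocNormSq k 0 = 2 / (2 * k + 1) := by
  have h1 := assocNormSq_eq_mul_zero k k le_rfl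
  have h2 : assocNormSq k k = (((2 * k).factorial : ℝ) / (2 ^ k * k.factorial)) ^ 2 *
      ∫ t in (-1 : ℝ)..1, ((1 - X ^ 2) ^ k : ℝ[X]).eval t := by
    rw [← integral_const_mul_eval, assocNormSq, legendreDeriv_self, C_pow]
    simp only [mul_comm]
  have h3 := integral_one_sub_sq_pow k
  rw [Nat.factorial_succ] at h3
  set W := ∫ t in (-1 : ℝ)..1, ((1 - X ^ 2) ^ k : ℝ[X]).eval t
  rw [h2, ← two_mul] at h1
  simp only [Nat.sub_self, Nat.factorial_zero, Nat.cast_one, mul_one] at h1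
  have hf : ((2 * k).factorial : ℝ) ≠ 0 := by positivity
  have hk : (k.factorial : ℝ) ≠ 0 := by positivity
  have hk1 : (2 * (k : ℝ) + 1) ≠ 0 := by positivity
  rw [eq_div_iff hk1]
  apply mul_left_cancel₀ hf
  rw [← mul_assoc, ← h1]
  push_cast at h3
  have e : (4 : ℝ) ^ k = (2 ^ k) ^ 2 := by rw [← pow_mul, mul_comm, pow_mul]; norm_num
  rw [e] at h3
  field_simp
  linear_combination h3

theorem assocNormSq_eq (k m : ℕ) (hm : m ≤ k) :
    assocNormSq k m = 2 / (2 * k + 1) * ((k + m).factorial / (k - m).factorial) := by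
  have h := assocNormSq_eq_mul_zero k m hm
  rw [assocNormSq_zero] at h
  have : ((k - m).factorial : ℝ) ≠ 0 := by positivity
  field_simp at *
  linear_combination h

/-- The polar factor of the Dirichlet integrand of a solid harmonic, as a polynomial in
`t = cos θ`. -/
noncomputable def dirichletPoly (k m : ℕ) (N : ℝ) : ℝ[X] :=
  (1 - X ^ 2) ^ m * (C (N ^ 2 - m ^ 2) * legendreDeriv k m ^ 2
    - 2 * (m : ℝ[X]) * X * legendreDeriv k m * legendreDeriv k (m + 1)
    + (1 - X ^ 2) * legendreDeriv k (m + 1) ^ 2)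

/-- The azimuthal part of the Dirichlet integrand of a solid harmonic. -/
noncomputable def azimuthPoly (k m : ℕ) : ℝ[X] :=
  (m : ℝ[X]) ^ 2 * (1 - X ^ 2) ^ (m - 1) * legendreDeriv k m ^ 2

/-- This is Green's identity on the sphere. The primitive is (1 - t²) p p' with p = (1 - t²)^(m/2) Q
and Q the m-th derivative of the Legendre polynomial; the Legendre equation removes the second
derivative of Q. -/
theorem integral_dirichletPoly (k m : ℕ) {N : ℝ} (hN : N * (N + 1) = k * (k + 1)) :
    ∫ t in (-1 : ℝ)..1, (dirichletPoly k m N + 2 * azimuthPoly k m).eval t =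
      N * (2 * N + 1) * assocNormSq k m := by
  rw [assocNormSq, ← integral_const_mul_eval]
  refine integral_eval_eq_of_derivative_eq (r := (1 - X ^ 2) ^ m * legendreDeriv k m *
    ((1 - X ^ 2) * legendreDeriv k (m + 1) - (m : ℝ[X]) * X * legendreDeriv k m)) ?_ ?_ ?_
  · have h := legendreDeriv_ode k m
    rw [← hN] at h
    simp only [derivative_mul, derivative_legendreDeriv, derivative_pow, derivative_sub,
      derivative_one, derivative_X, derivative_natCast, dirichletPoly, azimuthPoly]
    simp only [map_sub, map_mul, map_add, map_natCast, map_one, map_pow, map_ofNat,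
      Nat.cast_ofNat, Nat.add_one_sub_one, pow_one] at *
    rcases m with _ | m
    · simp only [Nat.cast_zero] at *
      linear_combination legendreDeriv k 0 * h
    · simp only [Nat.cast_add, Nat.cast_one, Nat.add_one_sub_one] at *
      linear_combination (1 - X ^ 2) ^ (m + 1) * legendreDeriv k (m + 1) * h
  · rcases m with _ | m <;> simp
  · rcases m with _ | m <;> simp

end SphericalMonogenics

/-! ### Spherical coordinates for lower Lebesgue integrals. -/

namespace SphericalMonogenics

open scoped ENNReal
open Real Set

theorem lintegral_eq_lintegral_polar (f : ℝ × ℝ → ℝ≥0∞) (hf : Measurable f) :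
    ∫⁻ p, f p = ∫⁻ r in Ioi (0 : ℝ), ∫⁻ φ in Ioo (-π) π,
      ENNReal.ofReal r * f (r * cos φ, r * sin φ) := by
  rw [← lintegral_comp_polarCoord_symm f, polarCoord_target, Measure.volume_eq_prod,
    ← Measure.prod_restrict, lintegral_prod]
  · simp
  · refine Measurable.aemeasurable ?_
    simp only [polarCoord_symm_apply, smul_eq_mul]
    fun_prop

/-- Extend f by zero below the axis and use planar polar coordinates; the extension vanishes for
angles in (-π, 0]. -/
theorem lintegral_halfPlane_eq_lintegral_polar (f : ℝ × ℝ → ℝ≥0∞) (hf : Measurable f) :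
    ∫⁻ z, ∫⁻ r in Ioi (0 : ℝ), f (z, r) = ∫⁻ ρ in Ioi (0 : ℝ), ∫⁻ θ in Ioo 0 π,
      ENNReal.ofReal ρ * f (ρ * cos θ, ρ * sin θ) := by
  have hg : Measurable (indicator {p : ℝ × ℝ | 0 < p.2} f) :=
    hf.indicator (measurableSet_lt measurable_const measurable_snd)
  have h := lintegral_eq_lintegral_polar _ hg
  rw [Measure.volume_eq_prod, lintegral_prod _ hg.aemeasurable] at h
  calc _ = ∫⁻ z, ∫⁻ r, indicator {p : ℝ × ℝ | 0 < p.2} f (z, r) := by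
        refine lintegral_congr fun z => ?_
        rw [← lintegral_indicator measurableSet_Ioi]
        rfl
    _ = _ := h
    _ = _ := by
        refine setLIntegral_congr_fun measurableSet_Ioi fun ρ hρ => ?_
        have hρ : 0 < ρ := hρ
        rw [← lintegral_indicator measurableSet_Ioo, ← lintegral_indicator measurableSet_Ioo]
        refine lintegral_congr fun θ => ?_
        by_cases h1 : θ ∈ Ioo 0 π
        · have h2 : θ ∈ Ioo (-π) π := ⟨by linarith [h1.1, pi_pos], h1.2⟩
          have h3 : 0 < ρ * sin θ := mul_pos hρ (sin_pos_of_mem_Ioo h1)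
          simp [h1, h2, h3, indicator]
        · rw [indicator_of_notMem h1]
          by_cases h2 : θ ∈ Ioo (-π) π
          · have h4 : θ ≤ 0 := by
              by_contra hc
              exact h1 ⟨not_le.mp hc, h2.2⟩
            have h3 : ¬ 0 < ρ * sin θ := by
              have := sin_nonpos_of_nonpos_of_neg_pi_le h4 h2.1.le
              exact not_lt.mpr (mul_nonpos_of_nonneg_of_nonpos hρ.le this)
            simp [h3, indicator]
          · rw [indicator_of_notMem h2]

theorem measurable_toLp_three : Measurable fun q : ℝ × ℝ × ℝ => (!₂[q.1, q.2.1, q.2.2] : R3) := by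
  refine (PiLp.volume_preserving_toLp (Fin 3)).measurable.comp (measurable_pi_lambda _ fun i => ?_)
  fin_cases i <;> simp <;> fun_prop

theorem lintegral_R3_eq (f : R3 → ℝ≥0∞) (hf : Measurable f) :
    ∫⁻ x, f x = ∫⁻ z, ∫⁻ p : ℝ × ℝ, f !₂[z, p.1, p.2] := by
  have hm : Measurable fun q : ℝ × ℝ × ℝ => f !₂[q.1, q.2.1, q.2.2] :=
    hf.comp measurable_toLp_three
  rw [← (PiLp.volume_preserving_toLp (Fin 3)).lintegral_comp hf]
  have e1 := (volume_preserving_piFinSuccAbove (fun _ : Fin 3 => ℝ) 0).symm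
  rw [← e1.lintegral_comp_emb (MeasurableEquiv.measurableEmbedding _)]
  have e2 := ((MeasurePreserving.id (volume : Measure ℝ)).prod
    (volume_preserving_finTwoArrow ℝ).symm)
  rw [Measure.volume_eq_prod, ← e2.lintegral_comp_emb]
  · rw [← lintegral_prod (f := fun q : ℝ × ℝ × ℝ => f !₂[q.1, q.2.1, q.2.2]) hm.aemeasurable]
    refine lintegral_congr fun q => ?_
    congr 2
    ext i
    fin_cases i <;> rfl
  · exact ((MeasurableEquiv.refl ℝ).prodCongr MeasurableEquiv.finTwoArrow.symm).measurableEmbedding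

/-- The point of `ℝ³` with the given spherical coordinates. -/
noncomputable def sphericalPoint (ρ θ φ : ℝ) : R3 :=
  !₂[ρ * cos θ, ρ * sin θ * cos φ, ρ * sin θ * sin φ]

/-- Polar coordinates are used twice, in the (x₁, x₂)-plane and then in the half-plane (x₀, r); the
Jacobians r = ρ sin θ and ρ multiply to ρ² sin θ. -/
theorem lintegral_eq_lintegral_spherical (f : R3 → ℝ≥0∞) (hf : Measurable f) :
    ∫⁻ x, f x = ∫⁻ ρ in Ioi (0 : ℝ), ∫⁻ θ in Ioo 0 π, ∫⁻ φ in Ioo (-π) π,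
      ENNReal.ofReal (ρ ^ 2 * sin θ) * f (sphericalPoint ρ θ φ) := by
  have hm : Measurable fun q : ℝ × ℝ × ℝ => f !₂[q.1, q.2.1, q.2.2] :=
    hf.comp measurable_toLp_three
  rw [lintegral_R3_eq f hf]
  have h1 : ∀ z : ℝ, ∫⁻ p : ℝ × ℝ, f !₂[z, p.1, p.2] = ∫⁻ r in Ioi (0 : ℝ),
      ∫⁻ φ in Ioo (-π) π, ENNReal.ofReal r * f !₂[z, r * cos φ, r * sin φ] := fun z =>
    lintegral_eq_lintegral_polar (fun p => f !₂[z, p.1, p.2])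
      (hm.comp (measurable_const.prodMk measurable_id))
  simp_rw [h1]
  have h2 := lintegral_halfPlane_eq_lintegral_polar
    (fun p => ∫⁻ φ in Ioo (-π) π, ENNReal.ofReal p.2 * f !₂[p.1, p.2 * cos φ, p.2 * sin φ]) ?_
  · rw [h2]
    refine setLIntegral_congr_fun measurableSet_Ioi fun ρ hρ => ?_
    refine setLIntegral_congr_fun measurableSet_Ioo fun θ hθ => ?_
    have hρ : 0 < ρ := hρ
    have hs := sin_pos_of_mem_Ioo hθ
    simp only
    rw [← lintegral_const_mul']
    · refine lintegral_congr fun φ => ?_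
      rw [← mul_assoc, ← ENNReal.ofReal_mul hρ.le, sphericalPoint]
      ring_nf
    · exact ENNReal.ofReal_ne_top
  · refine Measurable.lintegral_prod_right' (f := fun q : (ℝ × ℝ) × ℝ =>
      ENNReal.ofReal q.1.2 * f !₂[q.1.1, q.1.2 * cos q.2, q.1.2 * sin q.2]) ?_
    refine Measurable.mul (by fun_prop) ?_
    exact hm.comp (g := fun q : ℝ × ℝ × ℝ => f !₂[q.1, q.2.1, q.2.2])
      (f := fun q : (ℝ × ℝ) × ℝ => (q.1.1, q.1.2 * cos q.2, q.1.2 * sin q.2)) (by fun_prop)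

end SphericalMonogenics

/-! ### The gradient of a solid harmonic in Cartesian terms. -/

namespace SphericalMonogenics

/-- The real or imaginary part, according to the superscript. -/
noncomputable def partCLM : Sgn → ℂ →L[ℝ] ℝ
  | .plus => Complex.reCLM
  | .minus => Complex.imCLM

/-- The planar coordinates `x₁ + i x₂`. -/
def planar (x : R3) : ℂ := ⟨x 1, x 2⟩

theorem norm_sq_eq_sum (x : R3) : ‖x‖ ^ 2 = x 0 ^ 2 + x 1 ^ 2 + x 2 ^ 2 := by
  rw [EuclideanSpace.real_norm_sq_eq, Fin.sum_univ_three]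

theorem norm_planar_sq (x : R3) : ‖planar x‖ ^ 2 = x 1 ^ 2 + x 2 ^ 2 := by
  rw [Complex.sq_norm, Complex.normSq_apply]; simp [planar]; ring

/-- This is cos² + sin² = 1 for both signs at once; it eliminates the derivative of the angular
factor from the squared gradient. -/
theorem partCLM_sq_add_sq (s : Sgn) (w : ℂ) :
    partCLM s w ^ 2 + partCLM s (w * Complex.I) ^ 2 = ‖w‖ ^ 2 := by
  rw [Complex.sq_norm, Complex.normSq_apply]
  cases s <;> simp [partCLM] <;> ring

theorem partCLM_polar_pow (s : Sgn) (m : ℕ) (r φ : ℝ) :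
    partCLM s (((r : ℂ) * Complex.exp (φ * Complex.I)) ^ m) = r ^ m * angular s m φ := by
  have h : ((r : ℂ) * Complex.exp (φ * Complex.I)) ^ m =
      ((r ^ m : ℝ) : ℂ) * Complex.exp (((m * φ : ℝ) : ℂ) * Complex.I) := by
    rw [mul_pow, ← Complex.exp_nat_mul]
    push_cast
    ring_nf
  rw [h]
  cases s
  · simp only [partCLM, angular, Complex.reCLM_apply, Complex.re_ofReal_mul,
      Complex.exp_ofReal_mul_I_re]
  · simp only [partCLM, angular, Complex.imCLM_apply, Complex.im_ofReal_mul,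
      Complex.exp_ofReal_mul_I_im]

theorem norm_pow_mul_angular_azimuth (s : Sgn) (m : ℕ) (x : R3) :
    ‖planar x‖ ^ m * angular s m (azimuth x) = partCLM s (planar x ^ m) := by
  rw [← partCLM_polar_pow, azimuth]
  congr 2
  exact Complex.norm_mul_exp_arg_mul_I (planar x)

theorem abs_div_norm_le_one (x : R3) : |x 0 / ‖x‖| ≤ 1 := by
  rw [abs_div, abs_norm]
  refine div_le_one_of_le₀ ?_ (norm_nonneg x)
  exact PiLp.norm_apply_le x 0

theorem one_sub_div_norm_sq {x : R3} (hx : x ≠ 0) :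
    1 - (x 0 / ‖x‖) ^ 2 = (‖planar x‖ / ‖x‖) ^ 2 := by
  have hρ : ‖x‖ ≠ 0 := norm_ne_zero_iff.mpr hx
  rw [div_pow, div_pow, norm_planar_sq]
  field_simp
  rw [norm_sq_eq_sum]; ring

/-- The relation between the degree `N` of a solid harmonic and the degree `k` of its
Legendre polynomial. -/
def DegreeRel (N : ℤ) (k : ℕ) : Prop := N = k ∨ N = -(k : ℤ) - 1

theorem legendreP_eq_eval {N : ℤ} {k : ℕ} (h : DegreeRel N k) :
    legendreP N = fun t => (legendrePoly k).eval t := by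
  rcases h with rfl | rfl
  · exact funext (legendreP_natCast k)
  · rw [legendreP_neg_sub_one]
    exact funext (legendreP_natCast k)

/-- The zonal factor `ρ^(N-m) Q(x₀/ρ)` of a solid harmonic. -/
noncomputable def zonal (N : ℤ) (k m : ℕ) (x : R3) : ℝ :=
  ‖x‖ ^ (N - m) * (legendreDeriv k m).eval (x 0 / ‖x‖)

/-- The factor (sin θ)^m combines with Φ into the real or imaginary part of (x₁ + i x₂)^m. This
removes the azimuth, whose branch cut and axis would obstruct differentiation. -/
theorem solidHarmonic_eq {N : ℤ} {k : ℕ} (h : DegreeRel N k) (m : ℕ) (s : Sgn) {x : R3}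
    (hx : x ≠ 0) :
    solidHarmonic N m s x = zonal N k m x * partCLM s (planar x ^ m) := by
  have hρ : ‖x‖ ≠ 0 := norm_ne_zero_iff.mpr hx
  have hc : Real.cos (polarAngle x) = x 0 / ‖x‖ :=
    Real.cos_arccos (neg_le_of_abs_le (abs_div_norm_le_one x)) (le_of_abs_le (abs_div_norm_le_one x))
  rw [solidHarmonic, hc, assocLegendre, legendreP_eq_eval h, iteratedDeriv_eval,
    one_sub_div_norm_sq hx, Real.sqrt_sq (by positivity), ← norm_pow_mul_angular_azimuth, zonal,
    zpow_sub₀ hρ, zpow_natCast, legendreDeriv, div_pow]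
  ring

/-- The derivative of the zonal factor along the axis. -/
noncomputable def zonalAxial (N : ℤ) (k m : ℕ) (x : R3) : ℝ :=
  ‖x‖ ^ (N - m - 1) * (((N : ℝ) - m) * (x 0 / ‖x‖) * (legendreDeriv k m).eval (x 0 / ‖x‖) +
    (1 - (x 0 / ‖x‖) ^ 2) * (legendreDeriv k (m + 1)).eval (x 0 / ‖x‖))

/-- The derivative of the zonal factor in the direction `x₁` or `x₂`, divided by that
coordinate. -/
noncomputable def zonalRadial (N : ℤ) (k m : ℕ) (x : R3) : ℝ :=
  ‖x‖ ^ (N - m - 1) / ‖x‖ * (((N : ℝ) - m) * (legendreDeriv k m).eval (x 0 / ‖x‖) -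
    (x 0 / ‖x‖) * (legendreDeriv k (m + 1)).eval (x 0 / ‖x‖))

theorem hasDerivAt_norm_line {x : R3} (hx : x ≠ 0) (v : R3) :
    HasDerivAt (fun t : ℝ => ‖x + t • v‖) ((x 0 * v 0 + x 1 * v 1 + x 2 * v 2) / ‖x‖) 0 := by
  have e : (fun t : ℝ => ‖x + t • v‖) = fun t : ℝ =>
      Real.sqrt ((x 0 + t * v 0) ^ 2 + (x 1 + t * v 1) ^ 2 + (x 2 + t * v 2) ^ 2) := by
    ext t
    rw [← Real.sqrt_sq (norm_nonneg (x + t • v)), norm_sq_eq_sum]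
    simp
  have hl : ∀ i : Fin 3, HasDerivAt (fun t : ℝ => (x i + t * v i) ^ 2) (2 * x i * v i) 0 := by
    intro i
    have := (((hasDerivAt_id (0 : ℝ)).mul_const (v i)).const_add (x i)).fun_pow 2
    simpa using this
  have hx0 : ‖x‖ ≠ 0 := norm_ne_zero_iff.mpr hx
  have h := (((hl 0).fun_add (hl 1)).fun_add (hl 2)).sqrt (by
    simp only [zero_mul, add_zero]
    rw [← norm_sq_eq_sum]
    positivity)
  rw [e]
  convert h using 1
  simp only [zero_mul, add_zero]
  rw [← norm_sq_eq_sum, Real.sqrt_sq (norm_nonneg x)]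
  field_simp

theorem hasLineDerivAt_zonal (N : ℤ) (k m : ℕ) {x : R3} (hx : x ≠ 0) (v : R3) :
    HasLineDerivAt ℝ (zonal N k m) (v 0 * zonalAxial N k m x +
      (v 1 * x 1 + v 2 * x 2) * zonalRadial N k m x) x v := by
  have hρ : ‖x‖ ≠ 0 := norm_ne_zero_iff.mpr hx
  have hn := hasDerivAt_norm_line hx v
  have hn0 : ‖x + (0 : ℝ) • v‖ = ‖x‖ := by simp
  have h1 := (hasDerivAt_zpow (N - m) ‖x + (0 : ℝ) • v‖ (Or.inl (by rwa [hn0]))).comp (0 : ℝ) hn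
  have h2 : HasDerivAt (fun t : ℝ => x 0 + t * v 0) (v 0) 0 := by
    simpa using ((hasDerivAt_id (0 : ℝ)).mul_const (v 0)).const_add (x 0)
  have h3 := h2.fun_div hn (by rwa [hn0])
  have h4 := ((legendreDeriv k m).hasDerivAt ((x 0 + 0 * v 0) / ‖x + (0 : ℝ) • v‖)).comp (0 : ℝ) h3
  have h5 := h1.fun_mul h4
  rw [HasLineDerivAt]
  refine (h5.congr_deriv ?_)
  simp only [Function.comp, hn0, zero_mul, add_zero, derivative_legendreDeriv, zonalAxial,
    zonalRadial, Int.cast_sub, Int.cast_natCast]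
  rw [zpow_sub_one₀ hρ (N - m)]
  field_simp
  ring

theorem hasLineDerivAt_partCLM_planar_pow (s : Sgn) (m : ℕ) (x v : R3) :
    HasLineDerivAt ℝ (fun y => partCLM s (planar y ^ m))
      (v 1 * (m * partCLM s (planar x ^ (m - 1))) +
        v 2 * (m * partCLM s (planar x ^ (m - 1) * Complex.I))) x v := by
  have h1 : HasDerivAt (fun t : ℝ => planar (x + t • v)) (planar v) 0 := by
    have e : (fun t : ℝ => planar (x + t • v)) = fun t : ℝ => planar x + (t : ℂ) * planar v := by
      ext t; apply Complex.ext <;> simp [planar]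
    rw [e]
    simpa using (((hasDerivAt_id (0 : ℝ)).ofReal_comp).mul_const (planar v)).const_add (planar x)
  have h2 := (partCLM s).hasFDerivAt.comp_hasDerivAt (0 : ℝ) (h1.fun_pow m)
  rw [HasLineDerivAt]
  refine h2.congr_deriv ?_
  have e : (m : ℂ) * planar (x + (0 : ℝ) • v) ^ (m - 1) * planar v =
      (v 1 * m) • planar x ^ (m - 1) + (v 2 * m) • (planar x ^ (m - 1) * Complex.I) := by
    have hv : planar v = v 1 + v 2 * Complex.I := by apply Complex.ext <;> simp [planar]
    rw [hv]
    simp only [zero_smul, add_zero, Complex.real_smul]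
    push_cast
    ring
  rw [e, map_add, map_smul, map_smul]
  simp only [smul_eq_mul]
  ring

/-- The gradient of a solid harmonic, paired with `v`. -/
noncomputable def solidGrad (N : ℤ) (k m : ℕ) (s : Sgn) (x v : R3) : ℝ :=
  (v 0 * zonalAxial N k m x + (v 1 * x 1 + v 2 * x 2) * zonalRadial N k m x) *
      partCLM s (planar x ^ m) +
    zonal N k m x * (v 1 * (m * partCLM s (planar x ^ (m - 1))) +
      v 2 * (m * partCLM s (planar x ^ (m - 1) * Complex.I)))

theorem hasLineDerivAt_solidHarmonic {N : ℤ} {k : ℕ} (h : DegreeRel N k) (m : ℕ) (s : Sgn) {x : R3}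
    (hx : x ≠ 0) (v : R3) :
    HasLineDerivAt ℝ (solidHarmonic N m s) (solidGrad N k m s x v) x v := by
  have h1 : HasLineDerivAt ℝ (fun y => zonal N k m y * partCLM s (planar y ^ m))
      (solidGrad N k m s x v) x v := by
    have h2 := HasDerivAt.fun_mul (hasLineDerivAt_zonal N k m hx v)
      (hasLineDerivAt_partCLM_planar_pow s m x v)
    simpa [solidGrad, HasLineDerivAt] using h2
  refine h1.congr_of_eventuallyEq ?_
  filter_upwards [isOpen_ne.mem_nhds hx] with y hy
  exact solidHarmonic_eq h m s hy

theorem partialDeriv_coe {u : R3 → ℝ} {x : R3} {j : Fin 3} {d : ℝ}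
    (h : HasLineDerivAt ℝ u d x (EuclideanSpace.single j 1)) :
    partialDeriv j (fun y => ((u y : ℝ) : ℍ[ℝ])) x = (d : ℍ[ℝ]) := by
  have h1 : HasLineDerivAt ℝ (fun y => ((u y : ℝ) : ℍ[ℝ])) (d : ℍ[ℝ]) x
      (EuclideanSpace.single j 1) := by
    have h2 := HasDerivAt.smul_const h (1 : ℍ[ℝ])
    have e : ∀ r : ℝ, r • (1 : ℍ[ℝ]) = (r : ℍ[ℝ]) := fun r => by
      ext <;> simp
    simp only [e] at h2
    exact h2
  exact h1.lineDeriv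

theorem cauchyRiemannConj_coe {u : R3 → ℝ} {x : R3} {d : R3 → ℝ}
    (h : ∀ v, HasLineDerivAt ℝ u (d v) x v) :
    cauchyRiemannConj (fun y => ((u y : ℝ) : ℍ[ℝ])) x =
      ⟨d (EuclideanSpace.single 0 1), -d (EuclideanSpace.single 1 1),
        -d (EuclideanSpace.single 2 1), 0⟩ := by
  rw [cauchyRiemannConj, partialDeriv_coe (h _), partialDeriv_coe (h _), partialDeriv_coe (h _)]
  have h1 : e1.re = 0 ∧ e1.imI = 1 ∧ e1.imJ = 0 ∧ e1.imK = 0 := ⟨rfl, rfl, rfl, rfl⟩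
  have h2 : e2.re = 0 ∧ e2.imI = 0 ∧ e2.imJ = 1 ∧ e2.imK = 0 := ⟨rfl, rfl, rfl, rfl⟩
  ext <;> simp [Quaternion.re_mul, Quaternion.imI_mul, Quaternion.imJ_mul, Quaternion.imK_mul,
    h1, h2]

/-- The squared length of the gradient of a solid harmonic. -/
noncomputable def gradSq (N : ℤ) (k m : ℕ) (s : Sgn) (x : R3) : ℝ :=
  solidGrad N k m s x (EuclideanSpace.single 0 1) ^ 2 +
    solidGrad N k m s x (EuclideanSpace.single 1 1) ^ 2 +
    solidGrad N k m s x (EuclideanSpace.single 2 1) ^ 2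

theorem gradSq_eq (N : ℤ) (k m : ℕ) (s : Sgn) (x : R3) :
    gradSq N k m s x = partCLM s (planar x ^ m) ^ 2 * (zonalAxial N k m x ^ 2 +
        ‖planar x‖ ^ 2 * zonalRadial N k m x ^ 2 + 2 * m * zonalRadial N k m x * zonal N k m x) +
      zonal N k m x ^ 2 * m ^ 2 * (‖planar x‖ ^ 2) ^ (m - 1) := by
  have h1 := partCLM_sq_add_sq s (planar x ^ (m - 1))
  -- Euler's identity for the homogeneous polynomial Re or Im of (x₁ + i x₂)^m; it evaluates the
  -- cross term.
  have h2 : x 1 * (m * partCLM s (planar x ^ (m - 1))) +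
      x 2 * (m * partCLM s (planar x ^ (m - 1) * Complex.I)) =
      m * partCLM s (planar x ^ m) := by
    rcases m with _ | m
    · simp
    · have hz : planar x ^ (m + 1) = x 1 • planar x ^ m + x 2 • (planar x ^ m * Complex.I) := by
        have hv : planar x = x 1 + x 2 * Complex.I := by apply Complex.ext <;> simp [planar]
        rw [pow_succ]
        nth_rewrite 2 [hv]
        simp only [Complex.real_smul]
        ring
      rw [hz, map_add, map_smul, map_smul]
      simp only [smul_eq_mul, Nat.add_one_sub_one]
      ring
  have h3 : (‖planar x‖ ^ 2) ^ (m - 1) = ‖planar x ^ (m - 1)‖ ^ 2 := by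
    rw [norm_pow, ← pow_mul, ← pow_mul, mul_comm]
  rw [h3, ← h1, norm_planar_sq]
  simp only [gradSq, solidGrad, PiLp.single_apply]
  simp
  linear_combination 2 * zonalRadial N k m x * zonal N k m x * partCLM s (planar x ^ m) * h2

end SphericalMonogenics

/-! ### The Dirichlet integral in spherical coordinates. -/

namespace SphericalMonogenics

open scoped ENNReal
open Real Set

theorem planar_sphericalPoint (ρ θ φ : ℝ) :
    planar (sphericalPoint ρ θ φ) = ((ρ * sin θ : ℝ) : ℂ) * Complex.exp (φ * Complex.I) := by
  apply Complex.ext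
  · rw [Complex.re_ofReal_mul, Complex.exp_ofReal_mul_I_re]; rfl
  · rw [Complex.im_ofReal_mul, Complex.exp_ofReal_mul_I_im]; rfl

theorem norm_sphericalPoint {ρ : ℝ} (hρ : 0 ≤ ρ) (θ φ : ℝ) : ‖sphericalPoint ρ θ φ‖ = ρ := by
  rw [← sq_eq_sq₀ (norm_nonneg _) hρ, norm_sq_eq_sum]
  simp only [sphericalPoint, PiLp.toLp_apply, Matrix.cons_val]
  linear_combination ρ ^ 2 * sin_sq_add_cos_sq θ + (ρ * sin θ) ^ 2 * sin_sq_add_cos_sq φ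

theorem gradSq_sphericalPoint (N : ℤ) (k m : ℕ) (s : Sgn) {ρ : ℝ} (hρ : 0 < ρ) (θ φ : ℝ) :
    gradSq N k m s (sphericalPoint ρ θ φ) = ρ ^ (2 * N - 2) *
      (angular s m φ ^ 2 * (dirichletPoly k m N).eval (cos θ) +
        (azimuthPoly k m).eval (cos θ)) := by
  have h0 : sphericalPoint ρ θ φ 0 / ρ = cos θ := by
    simp [sphericalPoint, hρ.ne']
  have hs : sin θ ^ 2 = 1 - cos θ ^ 2 := sin_sq θ
  have hnp : ‖((ρ * sin θ : ℝ) : ℂ) * Complex.exp (φ * Complex.I)‖ ^ 2 =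
      ρ ^ 2 * (1 - cos θ ^ 2) := by
    rw [norm_mul, Complex.norm_exp_ofReal_mul_I, mul_one, Complex.norm_real, norm_eq_abs, sq_abs,
      mul_pow, hs]
  rw [gradSq_eq, planar_sphericalPoint, partCLM_polar_pow, hnp]
  simp only [zonal, zonalAxial, zonalRadial, norm_sphericalPoint hρ.le, h0, dirichletPoly,
    azimuthPoly, Polynomial.eval_add, Polynomial.eval_mul, Polynomial.eval_sub,
    Polynomial.eval_pow, Polynomial.eval_one, Polynomial.eval_X, Polynomial.eval_C,
    Polynomial.eval_natCast, Polynomial.eval_ofNat]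
  have hsm : (sin θ ^ m) ^ 2 = (1 - cos θ ^ 2) ^ m := by
    rw [← pow_mul, mul_comm, pow_mul, hs]
  have hR : ρ ^ (N - m) = ρ ^ (N - m - 1) * ρ := by
    rw [← zpow_add_one₀ hρ.ne']; ring_nf
  have hRR : ρ ^ (2 * N - 2) = (ρ ^ (N - m - 1) * ρ ^ m) ^ 2 := by
    rw [← zpow_natCast ρ m, ← zpow_add₀ hρ.ne', ← zpow_natCast, ← zpow_mul]
    congr 1; push_cast; ring
  rw [hR, hRR]
  set R := ρ ^ (N - m - 1)
  set q := Polynomial.eval (cos θ) (legendreDeriv k m)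
  set q' := Polynomial.eval (cos θ) (legendreDeriv k (m + 1))
  set c := cos θ
  have e1 : ((ρ * sin θ) ^ m * angular s m φ) ^ 2 =
      (ρ ^ m) ^ 2 * (1 - c ^ 2) ^ m * angular s m φ ^ 2 := by
    rw [← hsm, mul_pow ρ]; ring
  rw [e1]
  -- The truncated exponent m - 1 is harmless at m = 0, since its terms carry the factor m².
  rcases m with _ | m
  · simp only [Nat.cast_zero, pow_zero]
    field_simp
    ring
  · simp only [Nat.add_one_sub_one]
    rw [mul_pow (ρ ^ 2) (1 - c ^ 2) m]
    field_simp
    push_cast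
    ring

theorem integral_angular_sq (s : Sgn) (m : ℕ) (hs : ¬ (m = 0 ∧ s = Sgn.minus)) :
    ∫ φ in (-π)..π, angular s m φ ^ 2 = π * (kronecker 0 m + 1) := by
  rcases Nat.eq_zero_or_pos m with rfl | hm
  · cases s
    · simp [angular, kronecker]; ring
    · exact absurd ⟨rfl, rfl⟩ hs
  · have hm' : (m : ℝ) ≠ 0 := by positivity
    have hk : kronecker 0 m = 0 := by simp [kronecker, hm.ne]
    rw [hk]
    cases s
    · simp only [angular]
      rw [intervalIntegral.integral_comp_mul_left (fun x => cos x ^ 2) hm', integral_cos_sq]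
      simp only [mul_neg, sin_neg, sin_nat_mul_pi, smul_eq_mul]
      field_simp
      ring
    · simp only [angular]
      rw [intervalIntegral.integral_comp_mul_left (fun x => sin x ^ 2) hm', integral_sin_sq]
      simp only [mul_neg, sin_neg, sin_nat_mul_pi, smul_eq_mul]
      field_simp
      ring

theorem continuous_angular (s : Sgn) (m : ℕ) : Continuous (angular s m) := by
  cases s
  · exact Real.continuous_cos.comp (continuous_const.mul continuous_id)
  · exact Real.continuous_sin.comp (continuous_const.mul continuous_id)

theorem integral_sin_mul_eval_cos (p : Polynomial ℝ) :
    ∫ θ in (0 : ℝ)..π, sin θ * p.eval (cos θ) = ∫ t in (-1 : ℝ)..1, p.eval t := by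
  have h := intervalIntegral.integral_comp_mul_deriv (a := 0) (b := π) (f := cos)
    (f' := fun θ => -sin θ) (g := fun t => p.eval t) (fun θ _ => hasDerivAt_cos θ)
    (by fun_prop) p.continuous
  rw [cos_zero, cos_pi] at h
  rw [← neg_inj, ← intervalIntegral.integral_symm (-1) 1, ← h, ← intervalIntegral.integral_neg]
  congr 1; ext θ
  simp [mul_comm]

theorem lintegral_Ioo_ofReal {a b : ℝ} (hab : a ≤ b) {f : ℝ → ℝ} (hf : Continuous f)
    (h0 : ∀ t ∈ Ioo a b, 0 ≤ f t) :
    ∫⁻ t in Ioo a b, ENNReal.ofReal (f t) = ENNReal.ofReal (∫ t in a..b, f t) := by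
  rw [intervalIntegral.integral_of_le hab, integral_Ioc_eq_integral_Ioo,
    ofReal_integral_eq_lintegral_ofReal]
  · exact (hf.integrableOn_Icc).mono_set Ioo_subset_Icc_self
  · exact (ae_restrict_iff' measurableSet_Ioo).mpr (Filter.Eventually.of_forall h0)

/-- At ρ = 1 the expression is a sum of squares, the squared gradient on the unit sphere. -/
theorem angularDensity_nonneg (N : ℤ) (k m : ℕ) (s : Sgn) (θ φ : ℝ) :
    0 ≤ angular s m φ ^ 2 * (dirichletPoly k m N).eval (cos θ) +
      (azimuthPoly k m).eval (cos θ) := by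
  have h := gradSq_sphericalPoint N k m s one_pos θ φ
  rw [one_zpow, one_mul] at h
  rw [← h, gradSq]
  positivity

theorem lintegral_angularDensity {N : ℤ} {k : ℕ} (hN : DegreeRel N k) (m : ℕ) (s : Sgn)
    (hs : ¬ (m = 0 ∧ s = Sgn.minus)) :
    ∫⁻ θ in Ioo 0 π, ∫⁻ φ in Ioo (-π) π, ENNReal.ofReal (sin θ *
      (angular s m φ ^ 2 * (dirichletPoly k m N).eval (cos θ) +
        (azimuthPoly k m).eval (cos θ))) =
      ENNReal.ofReal (π * (kronecker 0 m + 1) * (N * (2 * N + 1) * assocNormSq k m)) := by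
  have hN' : (N : ℝ) * (N + 1) = k * (k + 1) := by
    rcases hN with rfl | rfl
    · simp
    · push_cast; ring
  have hang := continuous_angular s m
  have inner : ∀ θ : ℝ, ∫ φ in (-π)..π, sin θ *
      (angular s m φ ^ 2 * (dirichletPoly k m N).eval (cos θ) + (azimuthPoly k m).eval (cos θ)) =
      π * (kronecker 0 m + 1) *
        (sin θ * (dirichletPoly k m N + 2 * azimuthPoly k m).eval (cos θ)) := by
    intro θ
    rw [intervalIntegral.integral_const_mul, intervalIntegral.integral_add
      (by exact (by fun_prop : Continuous _).intervalIntegrable _ _)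
      (by exact (by fun_prop : Continuous _).intervalIntegrable _ _),
      intervalIntegral.integral_mul_const, integral_angular_sq s m hs,
      intervalIntegral.integral_const]
    simp only [Polynomial.eval_add, Polynomial.eval_mul, Polynomial.eval_ofNat, smul_eq_mul]
    -- The azimuthal part integrates to 2πA, which is π(δ + 1) · 2A because δ = 0 for m > 0 and A =
    -- 0 for m = 0.
    rcases Nat.eq_zero_or_pos m with rfl | hm
    · simp [azimuthPoly]; ring
    · simp only [kronecker, hm.ne, if_false]; ring
  have hnn : ∀ θ ∈ Ioo 0 π, ∀ φ, 0 ≤ sin θ * (angular s m φ ^ 2 *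
      (dirichletPoly k m N).eval (cos θ) + (azimuthPoly k m).eval (cos θ)) := fun θ hθ φ =>
    mul_nonneg (sin_pos_of_mem_Ioo hθ).le (angularDensity_nonneg N k m s θ φ)
  have inner' : ∀ θ ∈ Ioo 0 π, ∫⁻ φ in Ioo (-π) π, ENNReal.ofReal (sin θ *
      (angular s m φ ^ 2 * (dirichletPoly k m N).eval (cos θ) +
        (azimuthPoly k m).eval (cos θ))) = ENNReal.ofReal (π * (kronecker 0 m + 1) *
        (sin θ * (dirichletPoly k m N + 2 * azimuthPoly k m).eval (cos θ))) := fun θ hθ => by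
    rw [lintegral_Ioo_ofReal (by linarith [pi_pos]) (by fun_prop) (fun φ _ => hnn θ hθ φ), inner]
  rw [setLIntegral_congr_fun measurableSet_Ioo inner', lintegral_Ioo_ofReal pi_pos.le]
  · rw [intervalIntegral.integral_const_mul, integral_sin_mul_eval_cos, integral_dirichletPoly k m hN']
  · have := (dirichletPoly k m N + 2 * azimuthPoly k m).continuous.comp continuous_cos
    exact continuous_const.mul (continuous_sin.mul this)
  · intro θ hθ
    rw [← inner]
    exact intervalIntegral.integral_nonneg (by linarith [pi_pos]) fun φ _ => hnn θ hθ φ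

/-- The range of the radius in each of the two domains. -/
def radialRange : Side → Set ℝ
  | .i => Ioo 0 1
  | .e => Ioi 1

theorem radialRange_subset (σ : Side) : radialRange σ ⊆ Ioi 0 := by
  cases σ
  · exact fun x hx => hx.1
  · exact fun x hx => mem_Ioi.mpr (one_pos.trans (mem_Ioi.mp hx))

theorem measurableSet_radialRange (σ : Side) : MeasurableSet (radialRange σ) := by
  cases σ
  · exact measurableSet_Ioo
  · exact measurableSet_Ioi

theorem isOpen_domain (σ : Side) : IsOpen (domain σ) := by
  cases σ
  · exact isOpen_lt continuous_norm continuous_const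
  · exact isOpen_lt continuous_const continuous_norm

theorem sphericalPoint_mem_domain (σ : Side) {ρ : ℝ} (hρ : 0 < ρ) (θ φ : ℝ) :
    sphericalPoint ρ θ φ ∈ domain σ ↔ ρ ∈ radialRange σ := by
  cases σ <;> simp [domain, radialRange, norm_sphericalPoint hρ.le, hρ]

/-- The degrees for which `ρ ^ (2 N)` is integrable over the range of the radius. -/
def IsDegree : Side → ℤ → Prop
  | .i, N => 0 ≤ N
  | .e, N => N ≤ -1

theorem lintegral_radialRange (σ : Side) {N : ℤ}
    (h : IsDegree σ N) :
    ∫⁻ ρ in radialRange σ, ENNReal.ofReal (ρ ^ (2 * N)) =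
      ENNReal.ofReal (1 / |2 * (N : ℝ) + 1|) := by
  cases σ
  · have h : 0 ≤ N := h
    lift N to ℕ using h
    have e : ∀ ρ : ℝ, ρ ^ (2 * (N : ℤ)) = ρ ^ (2 * N) := fun ρ => by
      rw [← zpow_natCast]; push_cast; rfl
    simp only [e, radialRange]
    rw [lintegral_Ioo_ofReal zero_le_one (by fun_prop) (fun t ht => pow_nonneg ht.1.le _),
      integral_pow, abs_of_pos (by push_cast; positivity)]
    simp
  · have h : N ≤ -1 := h
    have hN : (2 * N : ℝ) < -1 := by
      have : (N : ℝ) ≤ -1 := by exact_mod_cast h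
      linarith
    have e : ∀ ρ ∈ Ioi (1 : ℝ), ENNReal.ofReal (ρ ^ (2 * N)) =
        ENNReal.ofReal (ρ ^ (2 * N : ℝ)) := fun ρ _ => by
      rw [← rpow_intCast]; push_cast; rfl
    rw [radialRange, setLIntegral_congr_fun measurableSet_Ioi e,
      ← ofReal_integral_eq_lintegral_ofReal, integral_Ioi_rpow_of_lt hN one_pos, one_rpow,
      abs_of_neg (by linarith)]
    · congr 1
      rw [div_neg, neg_div]
    · exact integrableOn_Ioi_rpow_of_lt hN one_pos
    · refine (ae_restrict_iff' measurableSet_Ioi).mpr (Filter.Eventually.of_forall fun ρ hρ => ?_)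
      exact rpow_nonneg (zero_le_one.trans (le_of_lt hρ)) _

theorem measurable_planar : Measurable planar := by
  have e : planar = fun x => (x 1 : ℂ) + x 2 * Complex.I := by
    ext x; apply Complex.ext <;> simp [planar]
  rw [e]; fun_prop

theorem measurable_solidGrad (N : ℤ) (k m : ℕ) (s : Sgn) (v : R3) :
    Measurable fun x => solidGrad N k m s x v := by
  have h1 := measurable_planar
  have h2 := fun j => (legendreDeriv k j).continuous.measurable
  have h3 : ∀ j, Measurable fun x : R3 => (legendreDeriv k j).eval (x 0 / ‖x‖) :=
    fun j => (h2 j).comp (by fun_prop)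
  have h4 := (partCLM s).measurable
  have h5 : ∀ j, Measurable fun x => partCLM s (planar x ^ j) := fun j =>
    h4.comp (h1.pow_const j)
  have h6 : Measurable fun x => partCLM s (planar x ^ (m - 1) * Complex.I) :=
    h4.comp ((h1.pow_const _).mul_const _)
  have h7 : ∀ z : ℤ, Measurable fun x : R3 => ‖x‖ ^ z := fun z => measurable_norm.pow_const z
  simp only [solidGrad, zonal, zonalAxial, zonalRadial]
  fun_prop

theorem measurable_gradSq (N : ℤ) (k m : ℕ) (s : Sgn) : Measurable (gradSq N k m s) :=
  (((measurable_solidGrad N k m s _).pow_const 2).add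
    ((measurable_solidGrad N k m s _).pow_const 2)).add
      ((measurable_solidGrad N k m s _).pow_const 2)

theorem lintegral_gradSq (σ : Side) {N : ℤ} {k : ℕ} (hN : DegreeRel N k) (m : ℕ) (s : Sgn)
    (hs : ¬ (m = 0 ∧ s = Sgn.minus)) (h : IsDegree σ N) :
    ∫⁻ x in domain σ, ENNReal.ofReal (gradSq N k m s x) =
      ENNReal.ofReal (1 / |2 * (N : ℝ) + 1| *
        (π * (kronecker 0 m + 1) * (N * (2 * N + 1) * assocNormSq k m))) := by
  have hd := (isOpen_domain σ).measurableSet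
  rw [← lintegral_indicator hd, lintegral_eq_lintegral_spherical _
    ((measurable_gradSq N k m s).ennreal_ofReal.indicator hd)]
  have e : ∀ ρ ∈ Ioi (0 : ℝ), (∫⁻ θ in Ioo 0 π, ∫⁻ φ in Ioo (-π) π,
      ENNReal.ofReal (ρ ^ 2 * sin θ) * (domain σ).indicator
        (fun x => ENNReal.ofReal (gradSq N k m s x)) (sphericalPoint ρ θ φ)) =
      (radialRange σ).indicator (fun ρ => ENNReal.ofReal (ρ ^ (2 * N))) ρ *
      ENNReal.ofReal (π * (kronecker 0 m + 1) * (N * (2 * N + 1) * assocNormSq k m)) := by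
    intro ρ hρ
    have hρ : 0 < ρ := hρ
    have htop : (radialRange σ).indicator (fun ρ => ENNReal.ofReal (ρ ^ (2 * N))) ρ ≠ ∞ := by
      by_cases hr : ρ ∈ radialRange σ <;> simp [hr]
    rw [← lintegral_angularDensity hN m s hs, ← lintegral_const_mul' _ _ htop]
    refine setLIntegral_congr_fun measurableSet_Ioo fun θ hθ => ?_
    rw [← lintegral_const_mul' _ _ htop]
    refine lintegral_congr fun φ => ?_
    have hsin := (sin_pos_of_mem_Ioo hθ).le
    by_cases hr : ρ ∈ radialRange σ
    · rw [indicator_of_mem ((sphericalPoint_mem_domain σ hρ θ φ).mpr hr), indicator_of_mem hr,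
        gradSq_sphericalPoint N k m s hρ, ← ENNReal.ofReal_mul (by positivity),
        ← ENNReal.ofReal_mul (by positivity)]
      congr 1
      -- The Jacobian supplies ρ² and the squared gradient ρ^(2N-2).
      have : ρ ^ (2 * N) = ρ ^ 2 * ρ ^ (2 * N - 2) := by
        rw [← zpow_natCast ρ 2, ← zpow_add₀ hρ.ne']; congr 1; push_cast; ring
      rw [this]; ring
    · rw [indicator_of_notMem fun hc => hr ((sphericalPoint_mem_domain σ hρ θ φ).mp hc),
        indicator_of_notMem hr, mul_zero, zero_mul]
  rw [setLIntegral_congr_fun measurableSet_Ioi e, lintegral_mul_const' _ _ ENNReal.ofReal_ne_top,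
    setLIntegral_indicator (measurableSet_radialRange σ),
    inter_eq_left.mpr (radialRange_subset σ), lintegral_radialRange σ h,
    ← ENNReal.ofReal_mul (by positivity)]

/-! ### From the gradient to the monogenic and its norm. -/

theorem basicMonogenic_eq {n : ℤ} {k : ℕ} (hN : DegreeRel (n + 1) k) (m : ℕ) (s : Sgn) {x : R3}
    (hx : x ≠ 0) :
    basicMonogenic n m s x = ⟨solidGrad (n + 1) k m s x (EuclideanSpace.single 0 1),
      -solidGrad (n + 1) k m s x (EuclideanSpace.single 1 1),
      -solidGrad (n + 1) k m s x (EuclideanSpace.single 2 1), 0⟩ :=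
  cauchyRiemannConj_coe fun v => hasLineDerivAt_solidHarmonic hN m s hx v

theorem ae_ne_zero (σ : Side) : ∀ᵐ x : R3 ∂volume.restrict (domain σ), x ≠ 0 :=
  ae_restrict_of_ae (by simp [ae_iff])

theorem aestronglyMeasurable_basicMonogenic (σ : Side) {n : ℤ} {k : ℕ}
    (hN : DegreeRel (n + 1) k) (m : ℕ) (s : Sgn) :
    AEStronglyMeasurable (basicMonogenic n m s) (volume.restrict (domain σ)) := by
  have hg := fun j : Fin 3 => (measurable_solidGrad (n + 1) k m s
    (EuclideanSpace.single j 1)).stronglyMeasurable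
  have h : StronglyMeasurable fun x : R3 =>
      solidGrad (n + 1) k m s x (EuclideanSpace.single 0 1) • (1 : ℍ[ℝ]) -
      solidGrad (n + 1) k m s x (EuclideanSpace.single 1 1) • e1 -
      solidGrad (n + 1) k m s x (EuclideanSpace.single 2 1) • e2 :=
    (((hg 0).smul_const _).sub ((hg 1).smul_const _)).sub ((hg 2).smul_const _)
  refine h.aestronglyMeasurable.congr ?_
  filter_upwards [ae_ne_zero σ] with x hx
  rw [basicMonogenic_eq hN m s hx]
  have h1 : e1.re = 0 ∧ e1.imI = 1 ∧ e1.imJ = 0 ∧ e1.imK = 0 := ⟨rfl, rfl, rfl, rfl⟩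
  have h2 : e2.re = 0 ∧ e2.imI = 0 ∧ e2.imJ = 1 ∧ e2.imK = 0 := ⟨rfl, rfl, rfl, rfl⟩
  ext <;> simp [h1, h2]

theorem gradSq_nonneg (N : ℤ) (k m : ℕ) (s : Sgn) (x : R3) : 0 ≤ gradSq N k m s x := by
  unfold gradSq; positivity

/-- Off the origin, a null set, the squared quaternion norm and the integrand of the scalar product
both equal `gradSq`, so one finite lower integral gives both claims. -/
theorem memLp_and_l2norm_sq (σ : Side) {n : ℤ} {k : ℕ} (hN : DegreeRel (n + 1) k) (m : ℕ) (s : Sgn)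
    {V : ℝ} (hV : 0 ≤ V)
    (h : ∫⁻ x in domain σ, ENNReal.ofReal (gradSq (n + 1) k m s x) = ENNReal.ofReal V) :
    MemLp (basicMonogenic n m s) 2 (volume.restrict (domain σ)) ∧
      l2norm σ (basicMonogenic n m s) ^ 2 = V := by
  have hnn := gradSq_nonneg (n + 1) k m s
  have hm := (measurable_gradSq (n + 1) k m s).aestronglyMeasurable
    (μ := volume.restrict (domain σ))
  have hI : ∫ x in domain σ, gradSq (n + 1) k m s x = V := by
    rw [integral_eq_lintegral_of_nonneg_ae (Filter.Eventually.of_forall hnn) hm, h,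
      ENNReal.toReal_ofReal hV]
  have hint : Integrable (gradSq (n + 1) k m s) (volume.restrict (domain σ)) := by
    refine ⟨hm, ?_⟩
    rw [hasFiniteIntegral_iff_ofReal (Filter.Eventually.of_forall hnn), h]
    exact ENNReal.ofReal_lt_top
  constructor
  · rw [memLp_two_iff_integrable_sq_norm (aestronglyMeasurable_basicMonogenic σ hN m s)]
    refine hint.congr ?_
    filter_upwards [ae_ne_zero σ] with x hx
    rw [pow_two, ← Quaternion.normSq_eq_norm_mul_self, Quaternion.normSq_def',
      basicMonogenic_eq hN m s hx]
    simp [gradSq]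
  · have hS : scalarProduct σ (basicMonogenic n m s) (basicMonogenic n m s) = V := by
      rw [← hI, scalarProduct]
      refine integral_congr_ae ?_
      filter_upwards [ae_ne_zero σ] with x hx
      rw [basicMonogenic_eq hN m s hx]
      simp only [gradSq]
      ring
    rw [l2norm, hS, Real.sq_sqrt hV]

end SphericalMonogenics

open SphericalMonogenics
theorem mainTheorem10 (σ : Side) (n : ℤ) (hn : n ∈ J σ) (m : ℕ) (hm : m ∈ IM σ n)
    (s : Sgn) (hs : ¬ (m = 0 ∧ s = Sgn.minus)) :
    MemLp (basicMonogenic n m s) 2 (volume.restrict (domain σ)) ∧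
    l2norm σ (basicMonogenic n m s) ^ 2 =
      2 * Real.pi * ((n : ℝ) + 1) * (kronecker 0 m + 1)
          * realFactorial (|(n : ℝ) + 3 / 2| + (m : ℝ) - 1 / 2)
        / ((2 * (n : ℝ) + 3) * realFactorial (|(n : ℝ) + 3 / 2| - (m : ℝ) - 1 / 2)) := by
  -- Everything that depends on the side is collected here. The witness is k = n + 1 inside and k =
  -- -n - 2 outside; outside, n + 1 and 2n + 3 are both negative, so their quotient stays
  -- nonnegative.
  have key : ∃ k : ℕ, DegreeRel (n + 1) k ∧ m ≤ k ∧ |(n : ℝ) + 3 / 2| = k + 1 / 2 ∧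
      IsDegree σ (n + 1) ∧
      0 ≤ ((n : ℝ) + 1) / (2 * n + 3) ∧
      1 / |2 * ((n + 1 : ℤ) : ℝ) + 1| * ((n + 1) * (2 * (n + 1) + 1) * (2 / (2 * k + 1))) =
        2 * ((n : ℝ) + 1) / (2 * n + 3) := by
    cases σ with
    | i =>
      have hn' : 0 ≤ n := hn
      have hm' : (m : ℤ) ≤ n + 1 := hm
      lift n to ℕ using hn'
      refine ⟨n + 1, Or.inl (by push_cast; rfl), by omega, ?_, by unfold IsDegree; omega, ?_, ?_⟩
      · push_cast
        rw [abs_of_pos (by positivity)]; ring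
      · push_cast; positivity
      · push_cast
        rw [abs_of_pos (by positivity)]
        field_simp
        ring
    | e =>
      have hn' : n ≤ -2 := hn
      have hm' : (m : ℤ) ≤ -(n + 1) - 1 := hm
      obtain ⟨k, rfl⟩ : ∃ k : ℕ, n = -(k : ℤ) - 2 := ⟨(-n - 2).toNat, by omega⟩
      have hk : (0 : ℝ) ≤ k := k.cast_nonneg
      refine ⟨k, Or.inr (by ring), by omega, ?_, by unfold IsDegree; omega, ?_, ?_⟩
      · push_cast
        rw [abs_of_neg (by linarith)]; ring
      · push_cast
        exact div_nonneg_of_nonpos (by linarith) (by linarith)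
      · push_cast
        rw [abs_of_neg (by linarith)]
        have h1 : (2 * (k : ℝ) + 1) ≠ 0 := by positivity
        have h2 : (2 * (-(k : ℝ) - 2) + 3) ≠ 0 := by linarith
        have h3 : -(2 * (-(k : ℝ) - 2 + 1) + 1) = 2 * k + 1 := by ring
        have h4 : (2 * (-(k : ℝ) - 2) + 3) = -(2 * k + 1) := by ring
        rw [h3, h4]
        field_simp
        ring
  obtain ⟨k, hN, hmk, habs, hrange, hpos, hval⟩ := key
  have hf1 : realFactorial (|(n : ℝ) + 3 / 2| + (m : ℝ) - 1 / 2) = (k + m).factorial := by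
    rw [realFactorial, habs, ← Real.Gamma_nat_eq_factorial]
    congr 1; push_cast; ring
  have hf2 : realFactorial (|(n : ℝ) + 3 / 2| - (m : ℝ) - 1 / 2) = (k - m).factorial := by
    rw [realFactorial, habs, ← Real.Gamma_nat_eq_factorial]
    congr 1; push_cast [Nat.cast_sub hmk]; ring
  have hk : 0 ≤ kronecker 0 m + 1 := by unfold kronecker; split_ifs <;> norm_num
  rw [hf1, hf2]
  refine memLp_and_l2norm_sq σ hN m s ?_ ?_
  · have e : 2 * Real.pi * ((n : ℝ) + 1) * (kronecker 0 m + 1) * ((k + m).factorial : ℝ) /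
        ((2 * n + 3) * ((k - m).factorial : ℝ)) = ((n : ℝ) + 1) / (2 * n + 3) *
        (2 * Real.pi * (kronecker 0 m + 1) * (k + m).factorial / (k - m).factorial) := by
      rw [div_mul_div_comm]; ring
    rw [e]
    refine mul_nonneg hpos ?_
    have := Real.pi_pos
    positivity
  · rw [lintegral_gradSq σ hN m s hs hrange, assocNormSq_eq k m hmk]
    congr 1
    have e : 2 * Real.pi * ((n : ℝ) + 1) * (kronecker 0 m + 1) * ((k + m).factorial : ℝ) /
        ((2 * n + 3) * ((k - m).factorial : ℝ)) = 2 * ((n : ℝ) + 1) / (2 * n + 3) *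
        (Real.pi * (kronecker 0 m + 1) * ((k + m).factorial / (k - m).factorial)) := by
      rw [mul_div_assoc', div_mul_div_comm]; ring
    rw [e, ← hval]
    push_cast
    ring
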